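/- A cubical $\omega$-category is understood in the sense of Al-Agl, Brown and Steiner: it has sets $\mathcal C_k$ ($k\ge 0$) of $k$-cells, face maps $\partial_i^{\alpha}:\mathcal C_k\to\mathcal C_{k-1}$, degeneracies $\epsilon_i:\mathcal C_{k-1}\to\mathcal C_k$ and partial compositions $\circ_i$ of $k$-cells ($1\le i\le k$, $\alpha\in\{-,+\}$), and connections $\Gamma_i^{\alpha}:\mathcal C_{k-1}\to\mathcal C_k$ ($1\le i<k$). A cubical $n$-category has the same structure with cells in dimensions $0,\dots,n$ only. Let $N\in\mathbb N\cup\{\omega\}$. A $k$-cell $A$ is $R_i$-invertible if there is a $k$-cell $B$ with $A\circ_i B=\epsilon_i\partial_i^-A$ and $B\circ_i A=\epsilon_i\partial_i^+A$. It has an $R_i$-invertible shell if $\partial_j^{\alpha}A$ is $R_{i-1}$-invertible for all $j<i$ and $R_i$-invertible for all $j>i$, and all $\alpha$. A cubical $N$-groupoid is a cubical $N$-category with connections in which, for all $1\le i\le k$, every $k$-cell with an $R_i$-invertible shell is $R_i$-invertible. For a cubical $N$-groupoid $\mathcal C$ let $\pi:\mathcal C_0\to\overline{\mathcal C}_0$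 be the coequaliser (in sets) of $\partial_1^-,\partial_1^+:\mathcal C_1\to\mathcal C_0$ (for $N=0$: the identity). A section is a map $\iota:\overline{\mathcal C}_0\to\mathcal C_0$ with $\pi\iota=\mathrm{id}$. For a $k$-cell $f$ put $\widehat f=\epsilon_k\cdots\epsilon_1\,\iota(\pi(\partial_1^-\cdots\partial_k^-f))$. A $\iota$-contraction is a family of maps $\sigma:\mathcal C_k\to\mathcal C_{k+1}$ (for $0\le k<N$) such that, whenever both sides are defined, $$\partial_1^-\sigma_f=f,\qquad \partial_1^+\sigma_f=\widehat f,\qquad \partial_{i+1}^{\alpha}\sigma_f=\sigma_{\partial_i^{\alpha}f},$$ $$\sigma_{f\circ_i g}=\sigma_f\circ_{i+1}\sigma_g,\qquad \sigma_{\epsilon_i f}=\epsilon_{i+1}\sigma_f,\qquad \sigma_{\Gamma_i^{\alpha}f}=\Gamma_{i+1}^{\alpha}\sigma_f,$$ $$\sigma_{\iota(u)}=\epsilon_1\iota(u)\ \ (u\in\overline{\mathcal C}_0),\qquad \sigma_{\sigma_f}=\Gamma_1^-\sigma_f.$$ $\mathcal C$ is contracting if it has a $\iota$-contraction for some section $\iota$.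 A $k$-square of $\mathcal C$ is a family $(f_i^{\alpha})_{1\le i\le k+1,\,\alpha\in\{-,+\}}$ of $k$-cells with $\partial_i^{\alpha}f_j^{\beta}=\partial_{j-1}^{\beta}f_i^{\alpha}$ for all $1\le i<j\le k+1$ and all $\alpha,\beta$ (no condition if $k=0$). A filler of it is a $(k+1)$-cell $A$ with $\partial_i^{\alpha}A=f_i^{\alpha}$ for all $i,\alpha$. **Theorem.** Every contracting cubical $\omega$-groupoid $\mathcal C$ is acyclic in the following sense: for every $k\ge 1$, every $k$-square of $\mathcal C$ has a filler, and every $0$-square $(x,y)$ with $\pi(x)=\pi(y)$ has a filler. The same holds for every contracting cubical $n$-groupoid, $n\in\mathbb N$, and all $k$ with $k+1\le n$ (in particular nothing is claimed for $n=0$). -/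

import Mathlib

universe u

/-- A cubical `N`-category with connections, for `N : ℕ∞`: a cubical `ω`-category when `N = ⊤`, and
a cubical `n`-category (cells in dimensions `0, …, n` only) when `N = n` is finite.

Signs are Booleans, `false` for `-` and `true` for `+`. Directions of a `k`-cell are counted from
`0`, so that they form `Fin k`. Degeneracies and connections exist as long as their values have
dimension at most `N`. In the axioms on composites, composability of each pair of cells that gets
composed is a hypothesis; where such a hypothesis concerns a composite, a degeneracy or a
connection, it is a consequence of the axioms on faces and of the composability of the given
cells. -/
structure CubicalCategory (N : ℕ∞) where
  /-- The `k`-cells. -/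
  Cell : ℕ → Type u
  isEmpty_cell : ∀ k : ℕ, N < (k : ℕ∞) → IsEmpty (Cell k)
  /-- The face maps. -/
  face : ∀ {k : ℕ}, Bool → Fin (k + 1) → Cell (k + 1) → Cell k
  /-- The degeneracy maps. -/
  deg : ∀ {k : ℕ}, ((k + 1 : ℕ) : ℕ∞) ≤ N → Fin (k + 1) → Cell k → Cell (k + 1)
  /-- The connection maps: `conn _ α i` involves the directions `i` and `i + 1`. -/
  conn : ∀ {k : ℕ}, ((k + 2 : ℕ) : ℕ∞) ≤ N → Bool → Fin (k + 1) → Cell (k + 1) → Cell (k + 2)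
  /-- The partial compositions: `comp i a b _` glues the upper face of `a` in direction `i` to the
  lower face of `b` in direction `i`. -/
  comp : ∀ {k : ℕ} (i : Fin (k + 1)) (a b : Cell (k + 1)),
    face true i a = face false i b → Cell (k + 1)
  -- Faces.
  face_face : ∀ {k : ℕ} (α β : Bool) (i j : Fin (k + 1)) (x : Cell (k + 2)), i ≤ j →
    face α i (face β j.succ x) = face β j (face α i.castSucc x)
  -- Faces of degeneracies.
  face_deg_lt : ∀ {k : ℕ} (h₁ : ((k + 1 : ℕ) : ℕ∞) ≤ N) (h₂ : ((k + 2 : ℕ) : ℕ∞) ≤ N)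
    (α : Bool) (i j : Fin (k + 1)) (x : Cell (k + 1)), i ≤ j →
    face α i.castSucc (deg h₂ j.succ x) = deg h₁ j (face α i x)
  face_deg_self : ∀ {k : ℕ} (h : ((k + 1 : ℕ) : ℕ∞) ≤ N) (α : Bool) (i : Fin (k + 1))
    (x : Cell k), face α i (deg h i x) = x
  face_deg_gt : ∀ {k : ℕ} (h₁ : ((k + 1 : ℕ) : ℕ∞) ≤ N) (h₂ : ((k + 2 : ℕ) : ℕ∞) ≤ N)
    (α : Bool) (i j : Fin (k + 1)) (x : Cell (k + 1)), j ≤ i →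
    face α i.succ (deg h₂ j.castSucc x) = deg h₁ j (face α i x)
  -- Degeneracies of degeneracies.
  deg_deg : ∀ {k : ℕ} (h₁ : ((k + 1 : ℕ) : ℕ∞) ≤ N) (h₂ : ((k + 2 : ℕ) : ℕ∞) ≤ N)
    (i j : Fin (k + 1)) (x : Cell k), i ≤ j →
    deg h₂ i.castSucc (deg h₁ j x) = deg h₂ j.succ (deg h₁ i x)
  -- Interchange law and associativity.
  interchange : ∀ {k : ℕ} (i j : Fin (k + 1)) (a b c d : Cell (k + 1)), i ≠ j →
    ∀ (hab : face true i a = face false i b) (hcd : face true i c = face false i d)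
      (hac : face true j a = face false j c) (hbd : face true j b = face false j d)
      (h : face true j (comp i a b hab) = face false j (comp i c d hcd))
      (h' : face true i (comp j a c hac) = face false i (comp j b d hbd)),
      comp j (comp i a b hab) (comp i c d hcd) h = comp i (comp j a c hac) (comp j b d hbd) h'
  assoc : ∀ {k : ℕ} (i : Fin (k + 1)) (a b c : Cell (k + 1))
    (hab : face true i a = face false i b) (hbc : face true i b = face false i c)
    (h : face true i a = face false i (comp i b c hbc))
    (h' : face true i (comp i a b hab) = face false i c),
    comp i a (comp i b c hbc) h = comp i (comp i a b hab) c h'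
  -- Degeneracies of composites.
  deg_comp_le : ∀ {k : ℕ} (h₂ : ((k + 2 : ℕ) : ℕ∞) ≤ N) (i j : Fin (k + 1))
    (a b : Cell (k + 1)), i ≤ j → ∀ (h : face true j a = face false j b)
    (h' : face true j.succ (deg h₂ i.castSucc a) = face false j.succ (deg h₂ i.castSucc b)),
    deg h₂ i.castSucc (comp j a b h) =
      comp j.succ (deg h₂ i.castSucc a) (deg h₂ i.castSucc b) h'
  deg_comp_gt : ∀ {k : ℕ} (h₂ : ((k + 2 : ℕ) : ℕ∞) ≤ N) (i j : Fin (k + 1))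
    (a b : Cell (k + 1)), j ≤ i → ∀ (h : face true j a = face false j b)
    (h' : face true j.castSucc (deg h₂ i.succ a) = face false j.castSucc (deg h₂ i.succ b)),
    deg h₂ i.succ (comp j a b h) = comp j.castSucc (deg h₂ i.succ a) (deg h₂ i.succ b) h'
  -- Identities.
  comp_id : ∀ {k : ℕ} (h₁ : ((k + 1 : ℕ) : ℕ∞) ≤ N) (i : Fin (k + 1)) (a : Cell (k + 1))
    (h : face true i a = face false i (deg h₁ i (face true i a))),
    comp i a (deg h₁ i (face true i a)) h = a
  id_comp : ∀ {k : ℕ} (h₁ : ((k + 1 : ℕ) : ℕ∞) ≤ N) (i : Fin (k + 1)) (a : Cell (k + 1))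
    (h : face true i (deg h₁ i (face false i a)) = face false i a),
    comp i (deg h₁ i (face false i a)) a h = a
  -- Faces of composites.
  face_comp_lt : ∀ {k : ℕ} (α : Bool) (i j : Fin (k + 1)) (a b : Cell (k + 2)), i ≤ j →
    ∀ (h : face true j.succ a = face false j.succ b)
      (h' : face true j (face α i.castSucc a) = face false j (face α i.castSucc b)),
      face α i.castSucc (comp j.succ a b h) =
        comp j (face α i.castSucc a) (face α i.castSucc b) h'
  face_comp_neg : ∀ {k : ℕ} (i : Fin (k + 1)) (a b : Cell (k + 1))
    (h : face true i a = face false i b), face false i (comp i a b h) = face false i a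
  face_comp_pos : ∀ {k : ℕ} (i : Fin (k + 1)) (a b : Cell (k + 1))
    (h : face true i a = face false i b), face true i (comp i a b h) = face true i b
  face_comp_gt : ∀ {k : ℕ} (α : Bool) (i j : Fin (k + 1)) (a b : Cell (k + 2)), j ≤ i →
    ∀ (h : face true j.castSucc a = face false j.castSucc b)
      (h' : face true j (face α i.succ a) = face false j (face α i.succ b)),
      face α i.succ (comp j.castSucc a b h) = comp j (face α i.succ a) (face α i.succ b) h'
  -- Faces of connections.
  face_conn_lt : ∀ {k : ℕ} (h₂ : ((k + 2 : ℕ) : ℕ∞) ≤ N) (h₃ : ((k + 3 : ℕ) : ℕ∞) ≤ N)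
    (α β : Bool) (i j : Fin (k + 1)) (x : Cell (k + 2)), i ≤ j →
    face α i.castSucc.castSucc (conn h₃ β j.succ x) = conn h₂ β j (face α i.castSucc x)
  face_conn_castSucc_same : ∀ {k : ℕ} (h₂ : ((k + 2 : ℕ) : ℕ∞) ≤ N) (α : Bool)
    (i : Fin (k + 1)) (x : Cell (k + 1)), face α i.castSucc (conn h₂ α i x) = x
  face_conn_succ_same : ∀ {k : ℕ} (h₂ : ((k + 2 : ℕ) : ℕ∞) ≤ N) (α : Bool)
    (i : Fin (k + 1)) (x : Cell (k + 1)), face α i.succ (conn h₂ α i x) = x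
  face_conn_castSucc_opp : ∀ {k : ℕ} (h₁ : ((k + 1 : ℕ) : ℕ∞) ≤ N)
    (h₂ : ((k + 2 : ℕ) : ℕ∞) ≤ N) (α : Bool) (i : Fin (k + 1)) (x : Cell (k + 1)),
    face α i.castSucc (conn h₂ (!α) i x) = deg h₁ i (face α i x)
  face_conn_succ_opp : ∀ {k : ℕ} (h₁ : ((k + 1 : ℕ) : ℕ∞) ≤ N)
    (h₂ : ((k + 2 : ℕ) : ℕ∞) ≤ N) (α : Bool) (i : Fin (k + 1)) (x : Cell (k + 1)),
    face α i.succ (conn h₂ (!α) i x) = deg h₁ i (face α i x)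
  face_conn_gt : ∀ {k : ℕ} (h₂ : ((k + 2 : ℕ) : ℕ∞) ≤ N) (h₃ : ((k + 3 : ℕ) : ℕ∞) ≤ N)
    (α β : Bool) (i j : Fin (k + 1)) (x : Cell (k + 2)), j ≤ i →
    face α i.succ.succ (conn h₃ β j.castSucc x) = conn h₂ β j (face α i.succ x)
  -- Connections of degeneracies.
  conn_deg_lt : ∀ {k : ℕ} (h₂ : ((k + 2 : ℕ) : ℕ∞) ≤ N) (h₃ : ((k + 3 : ℕ) : ℕ∞) ≤ N)
    (α : Bool) (i j : Fin (k + 1)) (x : Cell (k + 1)), i ≤ j →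
    conn h₃ α i.castSucc (deg h₂ j.succ x) = deg h₃ j.succ.succ (conn h₂ α i x)
  conn_deg_self : ∀ {k : ℕ} (h₁ : ((k + 1 : ℕ) : ℕ∞) ≤ N) (h₂ : ((k + 2 : ℕ) : ℕ∞) ≤ N)
    (α : Bool) (i : Fin (k + 1)) (x : Cell k),
    conn h₂ α i (deg h₁ i x) = deg h₂ i.castSucc (deg h₁ i x)
  conn_deg_gt : ∀ {k : ℕ} (h₂ : ((k + 2 : ℕ) : ℕ∞) ≤ N) (h₃ : ((k + 3 : ℕ) : ℕ∞) ≤ N)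
    (α : Bool) (i j : Fin (k + 1)) (x : Cell (k + 1)), j ≤ i →
    conn h₃ α i.succ (deg h₂ j.castSucc x) = deg h₃ j.castSucc.castSucc (conn h₂ α i x)
  -- Connections of connections.
  conn_conn_lt : ∀ {k : ℕ} (h₂ : ((k + 2 : ℕ) : ℕ∞) ≤ N) (h₃ : ((k + 3 : ℕ) : ℕ∞) ≤ N)
    (α β : Bool) (i j : Fin (k + 1)) (x : Cell (k + 1)), i < j →
    conn h₃ α i.castSucc (conn h₂ β j x) = conn h₃ β j.succ (conn h₂ α i x)
  conn_conn_self : ∀ {k : ℕ} (h₂ : ((k + 2 : ℕ) : ℕ∞) ≤ N) (h₃ : ((k + 3 : ℕ) : ℕ∞) ≤ N)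
    (α : Bool) (i : Fin (k + 1)) (x : Cell (k + 1)),
    conn h₃ α i.succ (conn h₂ α i x) = conn h₃ α i.castSucc (conn h₂ α i x)
  -- Transport laws.
  conn_comp_conn_castSucc : ∀ {k : ℕ} (h₂ : ((k + 2 : ℕ) : ℕ∞) ≤ N) (i : Fin (k + 1))
    (a : Cell (k + 1))
    (h : face true i.castSucc (conn h₂ true i a) = face false i.castSucc (conn h₂ false i a)),
    comp i.castSucc (conn h₂ true i a) (conn h₂ false i a) h = deg h₂ i.succ a
  conn_comp_conn_succ : ∀ {k : ℕ} (h₂ : ((k + 2 : ℕ) : ℕ∞) ≤ N) (i : Fin (k + 1))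
    (a : Cell (k + 1))
    (h : face true i.succ (conn h₂ true i a) = face false i.succ (conn h₂ false i a)),
    comp i.succ (conn h₂ true i a) (conn h₂ false i a) h = deg h₂ i.castSucc a
  -- Connections of composites.
  conn_comp_lt : ∀ {k : ℕ} (h₂ : ((k + 2 : ℕ) : ℕ∞) ≤ N) (α : Bool) (i j : Fin (k + 1))
    (a b : Cell (k + 1)), i < j → ∀ (h : face true j a = face false j b)
    (h' : face true j.succ (conn h₂ α i a) = face false j.succ (conn h₂ α i b)),
    conn h₂ α i (comp j a b h) = comp j.succ (conn h₂ α i a) (conn h₂ α i b) h'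
  conn_comp_neg : ∀ {k : ℕ} (h₂ : ((k + 2 : ℕ) : ℕ∞) ≤ N) (i : Fin (k + 1))
    (a b : Cell (k + 1)) (h : face true i a = face false i b)
    (h' : face true i.castSucc (conn h₂ false i a) = face false i.castSucc (deg h₂ i.succ b))
    (h'' : face true i.castSucc (deg h₂ i.castSucc b) =
      face false i.castSucc (conn h₂ false i b))
    (h''' : face true i.succ (comp i.castSucc (conn h₂ false i a) (deg h₂ i.succ b) h') =
      face false i.succ (comp i.castSucc (deg h₂ i.castSucc b) (conn h₂ false i b) h'')),
    conn h₂ false i (comp i a b h) =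
      comp i.succ (comp i.castSucc (conn h₂ false i a) (deg h₂ i.succ b) h')
        (comp i.castSucc (deg h₂ i.castSucc b) (conn h₂ false i b) h'') h'''
  conn_comp_pos : ∀ {k : ℕ} (h₂ : ((k + 2 : ℕ) : ℕ∞) ≤ N) (i : Fin (k + 1))
    (a b : Cell (k + 1)) (h : face true i a = face false i b)
    (h' : face true i.castSucc (conn h₂ true i a) = face false i.castSucc (deg h₂ i.castSucc a))
    (h'' : face true i.castSucc (deg h₂ i.succ a) = face false i.castSucc (conn h₂ true i b))
    (h''' : face true i.succ (comp i.castSucc (conn h₂ true i a) (deg h₂ i.castSucc a) h') =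
      face false i.succ (comp i.castSucc (deg h₂ i.succ a) (conn h₂ true i b) h'')),
    conn h₂ true i (comp i a b h) =
      comp i.succ (comp i.castSucc (conn h₂ true i a) (deg h₂ i.castSucc a) h')
        (comp i.castSucc (deg h₂ i.succ a) (conn h₂ true i b) h'') h'''
  conn_comp_gt : ∀ {k : ℕ} (h₂ : ((k + 2 : ℕ) : ℕ∞) ≤ N) (α : Bool) (i j : Fin (k + 1))
    (a b : Cell (k + 1)), j < i → ∀ (h : face true j a = face false j b)
    (h' : face true j.castSucc (conn h₂ α i a) = face false j.castSucc (conn h₂ α i b)),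
    conn h₂ α i (comp j a b h) = comp j.castSucc (conn h₂ α i a) (conn h₂ α i b) h'

namespace CubicalCategory

variable {N : ℕ∞} (C : CubicalCategory.{u} N)

/-- There are cells in dimensions at most `N` only. -/
theorem dim_le {k : ℕ} (x : C.Cell k) : (k : ℕ∞) ≤ N :=
  not_lt.mp fun h => (C.isEmpty_cell k h).false x

/-- `A` is `R_i`-invertible: it has an inverse for the composition in direction `i`. -/
def RInvertible {k : ℕ} (i : Fin (k + 1)) (A : C.Cell (k + 1)) : Prop :=
  ∃ (B : C.Cell (k + 1)) (hAB : C.face true i A = C.face false i B)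
    (hBA : C.face true i B = C.face false i A),
    C.comp i A B hAB = C.deg (C.dim_le A) i (C.face false i A) ∧
    C.comp i B A hBA = C.deg (C.dim_le A) i (C.face true i A)

/-- `A` has an `R_i`-invertible shell: for `j ≠ i`, its faces in direction `j` are invertible in the
direction `i'` that corresponds to `i` (`i' = i` if `i < j`, and `i' = i - 1` if `j < i`). A `1`-cell
has no face in another direction than `i`. -/
def HasRInvertibleShell : ∀ {k : ℕ}, Fin (k + 1) → C.Cell (k + 1) → Prop
  | 0, _, _ => True
  | _ + 1, i, A => ∀ (α : Bool),
      (∀ j i', j < i → i = Fin.succ i' → C.RInvertible i' (C.face α j A)) ∧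
      (∀ j i', i < j → i = Fin.castSucc i' → C.RInvertible i' (C.face α j A))

/-- `C` is an `N`-groupoid, that is, an `(N,0)`-category. -/
def IsGroupoid : Prop :=
  ∀ {k : ℕ} (i : Fin (k + 1)) (A : C.Cell (k + 1)),
    C.HasRInvertibleShell i A → C.RInvertible i A

/-- The set of `0`-cells of the quotient of `C` in dimension `0`: the coequaliser of the two face
maps from `1`-cells to `0`-cells. -/
def Quotient₀ : Type u :=
  Quot fun x y : C.Cell 0 => ∃ f : C.Cell 1, C.face false 0 f = x ∧ C.face true 0 f = y

/-- The class of a `0`-cell in the quotient. -/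
def mk₀ (x : C.Cell 0) : C.Quotient₀ := Quot.mk _ x

/-- The projection onto the quotient. All positive-dimensional cells of the quotient are degenerate,
so that a cell is sent to (a degeneracy of) the class of its vertex `∂_1^- … ∂_k^- f`. -/
def proj : ∀ {k : ℕ}, C.Cell k → C.Quotient₀
  | 0, x => C.mk₀ x
  | _ + 1, f => proj (C.face false (Fin.last _) f)

/-- The totally degenerate `k`-cell `ε_k … ε_1 x` on a `0`-cell `x`. -/
def iterDeg : ∀ (k : ℕ), (k : ℕ∞) ≤ N → C.Cell 0 → C.Cell k
  | 0, _, x => x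
  | k + 1, h, x =>
      C.deg h (Fin.last k) (iterDeg k (le_trans (Nat.cast_le.mpr k.le_succ) h) x)

/-- A section of the projection onto the quotient in dimension `0`: a functor from the terminal
category to the fibre over each class, that is, a representative `0`-cell of each class together with
its degeneracies. -/
structure ProjSection where
  /-- The representative of a class. -/
  rep : C.Quotient₀ → C.Cell 0
  mk₀_rep : ∀ u : C.Quotient₀, C.mk₀ (rep u) = u

/-- The cell `f̂`: the degenerate cell, of the dimension of `f`, on the representative of the class of
`f`. -/
def ProjSection.hat {C : CubicalCategory.{u} N} (ι : C.ProjSection) {k : ℕ} (f : C.Cell k) :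
    C.Cell k :=
  C.iterDeg k (C.dim_le f) (ι.rep (C.proj f))

/-- A contraction relative to a section `ι`: a lax transformation from the identity to `f ↦ f̂` on
(each fibre of) `C`, that satisfies `σ_{ι_u} = ε_1 ι_u` and `σ_{σ_f} = Γ_1^- σ_f`. -/
structure Contraction (ι : C.ProjSection) where
  /-- The `(k + 1)`-cell `σ_f` of a `k`-cell `f`. -/
  σ : ∀ {k : ℕ}, ((k + 1 : ℕ) : ℕ∞) ≤ N → C.Cell k → C.Cell (k + 1)
  face_zero_neg : ∀ {k : ℕ} (h₁ : ((k + 1 : ℕ) : ℕ∞) ≤ N) (f : C.Cell k),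
    C.face false 0 (σ h₁ f) = f
  face_zero_pos : ∀ {k : ℕ} (h₁ : ((k + 1 : ℕ) : ℕ∞) ≤ N) (f : C.Cell k),
    C.face true 0 (σ h₁ f) = ι.hat f
  face_succ : ∀ {k : ℕ} (h₁ : ((k + 1 : ℕ) : ℕ∞) ≤ N) (h₂ : ((k + 2 : ℕ) : ℕ∞) ≤ N)
    (α : Bool) (i : Fin (k + 1)) (f : C.Cell (k + 1)),
    C.face α i.succ (σ h₂ f) = σ h₁ (C.face α i f)
  σ_comp : ∀ {k : ℕ} (h₂ : ((k + 2 : ℕ) : ℕ∞) ≤ N) (i : Fin (k + 1)) (f g : C.Cell (k + 1))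
    (h : C.face true i f = C.face false i g)
    (h' : C.face true i.succ (σ h₂ f) = C.face false i.succ (σ h₂ g)),
    σ h₂ (C.comp i f g h) = C.comp i.succ (σ h₂ f) (σ h₂ g) h'
  σ_deg : ∀ {k : ℕ} (h₁ : ((k + 1 : ℕ) : ℕ∞) ≤ N) (h₂ : ((k + 2 : ℕ) : ℕ∞) ≤ N)
    (i : Fin (k + 1)) (f : C.Cell k), σ h₂ (C.deg h₁ i f) = C.deg h₂ i.succ (σ h₁ f)
  σ_conn : ∀ {k : ℕ} (h₂ : ((k + 2 : ℕ) : ℕ∞) ≤ N) (h₃ : ((k + 3 : ℕ) : ℕ∞) ≤ N)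
    (α : Bool) (i : Fin (k + 1)) (f : C.Cell (k + 1)),
    σ h₃ (C.conn h₂ α i f) = C.conn h₃ α i.succ (σ h₂ f)
  σ_rep : ∀ (h₁ : ((0 + 1 : ℕ) : ℕ∞) ≤ N) (u : C.Quotient₀),
    σ h₁ (ι.rep u) = C.deg h₁ 0 (ι.rep u)
  σ_σ : ∀ {k : ℕ} (h₁ : ((k + 1 : ℕ) : ℕ∞) ≤ N) (h₂ : ((k + 2 : ℕ) : ℕ∞) ≤ N)
    (f : C.Cell k), σ h₂ (σ h₁ f) = C.conn h₂ false 0 (σ h₁ f)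

/-- `C` is contracting: it has a contraction relative to some section. -/
def IsContracting : Prop :=
  ∃ ι : C.ProjSection, Nonempty (C.Contraction ι)

/-- The family `S` of `k`-cells is a `k`-square. -/
def IsSquare : ∀ {k : ℕ}, (Bool → Fin (k + 1) → C.Cell k) → Prop
  | 0, _ => True
  | k + 1, S => ∀ (α β : Bool) (i j : Fin (k + 1)), i ≤ j →
      C.face α i (S β j.succ) = C.face β j (S α i.castSucc)

/-- The boundary of a `(k + 1)`-cell. -/
def boundary {k : ℕ} (A : C.Cell (k + 1)) : Bool → Fin (k + 1) → C.Cell k :=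
  fun α i => C.face α i A

/-- `A` is a filler of the `k`-square `S`. -/
def IsFiller {k : ℕ} (S : Bool → Fin (k + 1) → C.Cell k) (A : C.Cell (k + 1)) : Prop :=
  C.boundary A = S

/-- Every `k`-square of `C` has a filler. -/
def SquaresHaveFillers (k : ℕ) : Prop :=
  ∀ S : Bool → Fin (k + 1) → C.Cell k, C.IsSquare S → ∃ A : C.Cell (k + 1), C.IsFiller S A

/-- Acyclicity relative to the quotient in dimension `0`: every `k`-square with `1 ≤ k < N` has a
filler, and (if `1 ≤ N`) so has every `0`-square whose two `0`-cells have the same class. -/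
def IsAcyclic : Prop :=
  (∀ k : ℕ, 1 ≤ k → ((k + 1 : ℕ) : ℕ∞) ≤ N → C.SquaresHaveFillers k) ∧
  (1 ≤ N → ∀ S : Bool → Fin (0 + 1) → C.Cell 0,
    C.mk₀ (S false 0) = C.mk₀ (S true 0) → ∃ A : C.Cell (0 + 1), C.IsFiller S A)

end CubicalCategory

/-! In a groupoid every cell is invertible in every direction, since the shell condition holds by
induction on the dimension. To fill a square it therefore suffices to fill one obtained by gluing
collars, in a direction `m`, to its two faces in that direction: inverse collars carry a filler back
(`IsNatSquare.exists_filler_of_comp`).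

The contraction provides the collars. The cell `σ g` leads from `g` to a totally degenerate cell,
but only in the first direction. Composing an inverse with a connection turns this direction into
the next one, as long as the faces of `g` passed on the way are totally degenerate
(`Contraction.exists_extension`). With such collars the faces in direction `m` become totally
degenerate, and those in directions below `m` stay so. Once all directions are treated, the square
is the boundary of a totally degenerate cell (`Contraction.exists_filler`). The same base point
serves throughout, because the faces of a square of positive dimension all lie over one class
(`IsSquare.proj_eq`). A `0`-square `(x, y)` is filled by `σ x` composed with the inverse of `σ y`.
-/

namespace CubicalCategory

variable {N : ℕ∞} (C : CubicalCategory.{u} N)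

/-! ### Cubical identities with directions in `ℕ` -/

/-- The face map in a direction given by a natural number. -/
def fc {k : ℕ} (α : Bool) (i : ℕ) (x : C.Cell (k + 1)) : C.Cell k :=
  C.face α (Fin.ofNat (k + 1) i) x

/-- The degeneracy in a direction given by a natural number. -/
def dg {k : ℕ} (h : ((k + 1 : ℕ) : ℕ∞) ≤ N) (i : ℕ) (x : C.Cell k) : C.Cell (k + 1) :=
  C.deg h (Fin.ofNat (k + 1) i) x

/-- The negative connection in a direction given by a natural number. -/
def cn {k : ℕ} (h : ((k + 2 : ℕ) : ℕ∞) ≤ N) (i : ℕ) (x : C.Cell (k + 1)) : C.Cell (k + 2) :=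
  C.conn h false (Fin.ofNat (k + 1) i) x

open Classical in
/-- The composition in a direction given by a natural number, extended to a total operation: its
value is the first argument where the composite is not defined. -/
noncomputable def cp {k : ℕ} (i : ℕ) (a b : C.Cell (k + 1)) : C.Cell (k + 1) :=
  if h : C.face true (Fin.ofNat (k + 1) i) a = C.face false (Fin.ofNat (k + 1) i) b then
    C.comp _ a b h
  else a

/-- The position of the direction `i` once the direction `p` has been removed. -/
def drop (p i : ℕ) : ℕ := if p < i then i - 1 else i

/-- `Fin.ofNat` reduces modulo the number of directions, so bounds are needed here and below. In
exchange, direction bookkeeping becomes arithmetic in `ℕ`. -/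
theorem ofNat_castSucc {k i : ℕ} (h : i ≤ k) :
    Fin.ofNat (k + 1 + 1) i = (Fin.ofNat (k + 1) i).castSucc := by
  ext
  simp [Fin.ofNat, Nat.mod_eq_of_lt (show i < k + 1 by omega),
    Nat.mod_eq_of_lt (show i < k + 1 + 1 by omega)]

theorem ofNat_succ {k i : ℕ} (h : i ≤ k) :
    Fin.ofNat (k + 1 + 1) (i + 1) = (Fin.ofNat (k + 1) i).succ := by
  ext
  simp [Fin.ofNat, Nat.mod_eq_of_lt (show i < k + 1 by omega),
    Nat.mod_eq_of_lt (show i + 1 < k + 1 + 1 by omega)]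

theorem ofNat_le_ofNat {k i j : ℕ} (hij : i ≤ j) (hj : j ≤ k) :
    Fin.ofNat (k + 1) i ≤ Fin.ofNat (k + 1) j := by
  rw [Fin.le_def]
  simpa [Fin.ofNat, Nat.mod_eq_of_lt (show i < k + 1 by omega),
    Nat.mod_eq_of_lt (show j < k + 1 by omega)] using hij

theorem ofNat_val {k : ℕ} (i : Fin (k + 1)) : Fin.ofNat (k + 1) i.val = i := by
  ext
  simp [Fin.ofNat, Nat.mod_eq_of_lt i.isLt]

theorem fc_val {k : ℕ} (α : Bool) (i : Fin (k + 1)) (x : C.Cell (k + 1)) :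
    C.fc α i.val x = C.face α i x := by
  rw [fc, ofNat_val]

theorem fc_fc_of_le {k i j : ℕ} (hij : i ≤ j) (hj : j ≤ k) (α β : Bool) (x : C.Cell (k + 2)) :
    C.fc α i (C.fc β (j + 1) x) = C.fc β j (C.fc α i x) := by
  simp only [fc]
  rw [ofNat_castSucc (hij.trans hj), ofNat_succ hj]
  exact C.face_face _ _ _ _ _ (ofNat_le_ofNat hij hj)

/-- Using `drop` on both sides makes the cubical identity symmetric in `i` and `p`, so that later
arguments need not distinguish `p < i` from `i < p`. -/
theorem fc_fc {k i p : ℕ} (hip : p ≠ i) (hi : i ≤ k + 1) (hp : p ≤ k + 1) (α β : Bool)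
    (x : C.Cell (k + 2)) :
    C.fc β (drop p i) (C.fc α p x) = C.fc α (drop i p) (C.fc β i x) := by
  rcases Nat.lt_or_gt_of_ne hip with h | h
  · obtain ⟨j, rfl⟩ : ∃ j, i = j + 1 := ⟨i - 1, by omega⟩
    rw [drop, drop, if_pos h, if_neg (by omega)]
    exact (C.fc_fc_of_le (by omega) (by omega) _ _ _).symm
  · obtain ⟨j, rfl⟩ : ∃ j, p = j + 1 := ⟨p - 1, by omega⟩
    rw [drop, drop, if_pos h, if_neg (by omega)]
    exact C.fc_fc_of_le (by omega) (by omega) _ _ _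

theorem cp_eq {k i : ℕ} {a b : C.Cell (k + 1)}
    (h : C.face true (Fin.ofNat (k + 1) i) a = C.face false (Fin.ofNat (k + 1) i) b) :
    C.cp i a b = C.comp _ a b h := dif_pos h

theorem fc_false_cp {k i : ℕ} {a b : C.Cell (k + 1)} (h : C.fc true i a = C.fc false i b) :
    C.fc false i (C.cp i a b) = C.fc false i a := by
  rw [C.cp_eq h]
  exact C.face_comp_neg _ _ _ _

theorem fc_true_cp {k i : ℕ} {a b : C.Cell (k + 1)} (h : C.fc true i a = C.fc false i b) :
    C.fc true i (C.cp i a b) = C.fc true i b := by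
  rw [C.cp_eq h]
  exact C.face_comp_pos _ _ _ _

theorem composable_fc {k i p : ℕ} (hip : p ≠ i) (hi : i ≤ k + 1) (hp : p ≤ k + 1) (α : Bool)
    {a b : C.Cell (k + 2)} (h : C.fc true i a = C.fc false i b) :
    C.fc true (drop p i) (C.fc α p a) = C.fc false (drop p i) (C.fc α p b) := by
  rw [C.fc_fc hip hi hp, C.fc_fc hip hi hp, h]

theorem fc_cp {k i p : ℕ} (hip : p ≠ i) (hi : i ≤ k + 1) (hp : p ≤ k + 1) (α : Bool)
    {a b : C.Cell (k + 2)} (h : C.fc true i a = C.fc false i b) :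
    C.fc α p (C.cp i a b) = C.cp (drop p i) (C.fc α p a) (C.fc α p b) := by
  have h' := C.composable_fc hip hi hp α h
  rw [C.cp_eq h, C.cp_eq h']
  simp only [fc] at h h' ⊢
  rcases Nat.lt_or_gt_of_ne hip with hlt | hlt
  · obtain ⟨j, rfl⟩ : ∃ j, i = j + 1 := ⟨i - 1, by omega⟩
    have e : drop p (j + 1) = j := by rw [drop, if_pos hlt, Nat.add_sub_cancel]
    have e₁ := ofNat_castSucc (k := k) (i := p) (by omega)
    have e₂ := ofNat_succ (k := k) (i := j) (by omega)
    simp only [e, e₁, e₂] at h h' ⊢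
    exact C.face_comp_lt _ _ _ _ _ (ofNat_le_ofNat (by omega) (by omega)) _ _
  · obtain ⟨j, rfl⟩ : ∃ j, p = j + 1 := ⟨p - 1, by omega⟩
    have e : drop (j + 1) i = i := by rw [drop, if_neg (by omega)]
    have e₁ := ofNat_castSucc (k := k) (i := i) (by omega)
    have e₂ := ofNat_succ (k := k) (i := j) (by omega)
    simp only [e, e₁, e₂] at h h' ⊢
    exact C.face_comp_gt _ _ _ _ _ (ofNat_le_ofNat (by omega) (by omega)) _ _

theorem cp_assoc {k i : ℕ} {a b c : C.Cell (k + 1)} (hab : C.fc true i a = C.fc false i b)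
    (hbc : C.fc true i b = C.fc false i c) :
    C.cp i a (C.cp i b c) = C.cp i (C.cp i a b) c := by
  have h₁ : C.fc true i a = C.fc false i (C.cp i b c) := by rw [C.fc_false_cp hbc, hab]
  have h₂ : C.fc true i (C.cp i a b) = C.fc false i c := by rw [C.fc_true_cp hab, hbc]
  rw [C.cp_eq h₁, C.cp_eq h₂]
  simp only [C.cp_eq hab, C.cp_eq hbc]
  exact C.assoc _ _ _ _ _ _ _ _

theorem fc_dg_self {k : ℕ} (h : ((k + 1 : ℕ) : ℕ∞) ≤ N) (α : Bool) (i : ℕ) (x : C.Cell k) :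
    C.fc α i (C.dg h i x) = x := C.face_deg_self _ _ _ _

theorem fc_dg {k i p : ℕ} (hip : p ≠ i) (hi : i ≤ k + 1) (hp : p ≤ k + 1)
    (h₁ : ((k + 1 : ℕ) : ℕ∞) ≤ N) (h₂ : ((k + 2 : ℕ) : ℕ∞) ≤ N) (α : Bool)
    (x : C.Cell (k + 1)) :
    C.fc α p (C.dg h₂ i x) = C.dg h₁ (drop p i) (C.fc α (drop i p) x) := by
  simp only [fc, dg]
  rcases Nat.lt_or_gt_of_ne hip with hlt | hlt
  · obtain ⟨j, rfl⟩ : ∃ j, i = j + 1 := ⟨i - 1, by omega⟩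
    rw [drop, drop, if_pos hlt, if_neg (by omega), Nat.add_sub_cancel,
      ofNat_castSucc (i := p) (by omega), ofNat_succ (by omega)]
    exact C.face_deg_lt _ _ _ _ _ _ (ofNat_le_ofNat (by omega) (by omega))
  · obtain ⟨j, rfl⟩ : ∃ j, p = j + 1 := ⟨p - 1, by omega⟩
    rw [drop, drop, if_pos hlt, if_neg (by omega), Nat.add_sub_cancel,
      ofNat_castSucc (i := i) (by omega), ofNat_succ (by omega)]
    exact C.face_deg_gt _ _ _ _ _ _ (ofNat_le_ofNat (by omega) (by omega))

theorem cp_dg {k i : ℕ} (h : ((k + 1 : ℕ) : ℕ∞) ≤ N) {a : C.Cell (k + 1)} {x : C.Cell k}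
    (hx : C.fc true i a = x) : C.cp i a (C.dg h i x) = a := by
  subst hx
  exact (C.cp_eq (C.fc_dg_self h false i _).symm).trans (C.comp_id _ _ _ _)

theorem dg_cp {k i : ℕ} (h : ((k + 1 : ℕ) : ℕ∞) ≤ N) {a : C.Cell (k + 1)} {x : C.Cell k}
    (hx : C.fc false i a = x) : C.cp i (C.dg h i x) a = a := by
  subst hx
  exact (C.cp_eq (C.fc_dg_self h true i _)).trans (C.id_comp _ _ _ _)

theorem fc_false_cn {k i : ℕ} (h₂ : ((k + 2 : ℕ) : ℕ∞) ≤ N) (hi : i ≤ k) (x : C.Cell (k + 1)) :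
    C.fc false i (C.cn h₂ i x) = x := by
  simp only [fc, cn]
  rw [ofNat_castSucc hi]
  exact C.face_conn_castSucc_same _ _ _ _

theorem fc_false_succ_cn {k i : ℕ} (h₂ : ((k + 2 : ℕ) : ℕ∞) ≤ N) (hi : i ≤ k)
    (x : C.Cell (k + 1)) : C.fc false (i + 1) (C.cn h₂ i x) = x := by
  simp only [fc, cn]
  rw [ofNat_succ hi]
  exact C.face_conn_succ_same _ _ _ _

theorem fc_true_cn {k i : ℕ} (h₁ : ((k + 1 : ℕ) : ℕ∞) ≤ N) (h₂ : ((k + 2 : ℕ) : ℕ∞) ≤ N)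
    (hi : i ≤ k) (x : C.Cell (k + 1)) :
    C.fc true i (C.cn h₂ i x) = C.dg h₁ i (C.fc true i x) := by
  simp only [fc, cn, dg]
  rw [ofNat_castSucc hi]
  exact C.face_conn_castSucc_opp _ _ true _ _

theorem fc_true_succ_cn {k i : ℕ} (h₁ : ((k + 1 : ℕ) : ℕ∞) ≤ N) (h₂ : ((k + 2 : ℕ) : ℕ∞) ≤ N)
    (hi : i ≤ k) (x : C.Cell (k + 1)) :
    C.fc true (i + 1) (C.cn h₂ i x) = C.dg h₁ i (C.fc true i x) := by
  simp only [fc, cn, dg]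
  rw [ofNat_succ hi]
  exact C.face_conn_succ_opp _ _ true _ _

theorem fc_cn_of_lt {k i p : ℕ} (h₂ : ((k + 2 : ℕ) : ℕ∞) ≤ N) (h₃ : ((k + 3 : ℕ) : ℕ∞) ≤ N)
    (hp : p ≤ i) (hi : i ≤ k) (α : Bool) (x : C.Cell (k + 2)) :
    C.fc α p (C.cn h₃ (i + 1) x) = C.cn h₂ i (C.fc α p x) := by
  simp only [fc, cn]
  rw [ofNat_castSucc (i := p) (by omega), ofNat_castSucc (i := p) (by omega), ofNat_succ hi]
  exact C.face_conn_lt _ _ _ _ _ _ _ (ofNat_le_ofNat hp hi)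

theorem fc_cn_of_gt {k i p : ℕ} (h₂ : ((k + 2 : ℕ) : ℕ∞) ≤ N) (h₃ : ((k + 3 : ℕ) : ℕ∞) ≤ N)
    (hi : i ≤ p) (hp : p ≤ k) (α : Bool) (x : C.Cell (k + 2)) :
    C.fc α (p + 2) (C.cn h₃ i x) = C.cn h₂ i (C.fc α (p + 1) x) := by
  simp only [fc, cn]
  rw [ofNat_succ (i := p + 1) (by omega), ofNat_succ (i := p) (by omega),
    ofNat_castSucc (i := i) (by omega)]
  exact C.face_conn_gt _ _ _ _ _ _ _ (ofNat_le_ofNat hi hp)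

/-! ### Invertibility in a groupoid -/

variable {C}

/-- Induction on the dimension: the shell of a `1`-cell is empty, and that of a higher cell consists
of cells of lower dimension, already invertible. -/
theorem IsGroupoid.rInvertible (hG : C.IsGroupoid) :
    ∀ {k : ℕ} (i : Fin (k + 1)) (A : C.Cell (k + 1)), C.RInvertible i A
  | 0, i, A => hG i A trivial
  | _ + 1, i, A => hG i A fun α =>
      ⟨fun j i' _ _ => hG.rInvertible i' (C.face α j A),
        fun j i' _ _ => hG.rInvertible i' (C.face α j A)⟩

theorem IsGroupoid.exists_inverse (hG : C.IsGroupoid) {k : ℕ} (h : ((k + 1 : ℕ) : ℕ∞) ≤ N)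
    (i : ℕ) (A : C.Cell (k + 1)) :
    ∃ B : C.Cell (k + 1), C.fc true i A = C.fc false i B ∧ C.fc true i B = C.fc false i A ∧
      C.cp i A B = C.dg h i (C.fc false i A) ∧ C.cp i B A = C.dg h i (C.fc true i A) := by
  obtain ⟨B, hAB, hBA, h₁, h₂⟩ := hG.rInvertible (Fin.ofNat (k + 1) i) A
  exact ⟨B, hAB, hBA, (C.cp_eq hAB).trans h₁, (C.cp_eq hBA).trans h₂⟩

/-! ### Gluing collars to a square -/

variable (C)

/-- The cells `T α p`, for `p ≤ k + 1`, form a `(k + 1)`-square. -/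
def IsNatSquare {k : ℕ} (T : Bool → ℕ → C.Cell (k + 1)) : Prop :=
  ∀ (α β : Bool) (i p : ℕ), p ≠ i → i ≤ k + 1 → p ≤ k + 1 →
    C.fc β (drop p i) (T α p) = C.fc α (drop i p) (T β i)

variable {C}

/-- Composing a square on both sides in the direction `i` gives a square, and a filler of the latter
gives one of the former. -/
theorem IsNatSquare.exists_filler_of_comp {k : ℕ} {T : Bool → ℕ → C.Cell (k + 1)}
    (hT : C.IsNatSquare T) (h₁ : ((k + 1 : ℕ) : ℕ∞) ≤ N) (h₂ : ((k + 2 : ℕ) : ℕ∞) ≤ N)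
    {i : ℕ} (hi : i ≤ k + 1) {B B' D D' : C.Cell (k + 2)}
    (hB : C.fc true i B = T false i) (hB' : C.fc true i B' = C.fc false i B)
    (hBB : C.cp i B' B = C.dg h₂ i (T false i)) (hB'T : C.fc false i B' = T false i)
    (hD : C.fc false i D = T true i) (hD' : C.fc true i D = C.fc false i D')
    (hDD : C.cp i D D' = C.dg h₂ i (T true i)) (hD'T : C.fc true i D' = T true i)
    {T' : Bool → ℕ → C.Cell (k + 1)}
    (hT'false : T' false i = C.fc false i B) (hT'true : T' true i = C.fc true i D)
    (hT' : ∀ α p, p ≠ i → T' α p =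
      C.cp (drop p i) (C.fc α p B) (C.cp (drop p i) (T α p) (C.fc α p D))) :
    C.IsNatSquare T' ∧ ∀ A' : C.Cell (k + 2), (∀ α p, p ≤ k + 1 → C.fc α p A' = T' α p) →
      ∃ A : C.Cell (k + 2), ∀ α p, p ≤ k + 1 → C.fc α p A = T α p := by
  have hBT : ∀ α p, p ≠ i → p ≤ k + 1 →
      C.fc true (drop p i) (C.fc α p B) = C.fc false (drop p i) (T α p) := fun α p hpi hp => by
    rw [C.fc_fc hpi hi hp, hB, hT α false i p hpi hi hp]
  have hTD : ∀ α p, p ≠ i → p ≤ k + 1 →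
      C.fc true (drop p i) (T α p) = C.fc false (drop p i) (C.fc α p D) := fun α p hpi hp => by
    rw [C.fc_fc hpi hi hp, hD, hT α true i p hpi hi hp]
  have hBTD : ∀ α p, p ≠ i → p ≤ k + 1 → C.fc true (drop p i) (C.fc α p B) =
      C.fc false (drop p i) (C.cp (drop p i) (T α p) (C.fc α p D)) := fun α p hpi hp => by
    rw [C.fc_false_cp (hTD α p hpi hp), hBT α p hpi hp]
  -- Compatibility with the two faces in direction `i`: the outer ends of the composite are faces of
  -- `B` and `D`.
  have key : ∀ α β p, p ≠ i → p ≤ k + 1 →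
      C.fc β (drop p i) (T' α p) = C.fc α (drop i p) (T' β i) := by
    intro α β p hpi hp
    rw [hT' α p hpi]
    cases β
    · rw [C.fc_false_cp (hBTD α p hpi hp), hT'false, C.fc_fc hpi hi hp]
    · rw [C.fc_true_cp (hBTD α p hpi hp), C.fc_true_cp (hTD α p hpi hp), hT'true,
        C.fc_fc hpi hi hp]
  constructor
  · intro α β q p hpq hq hp
    by_cases hqi : q = i
    · subst hqi
      exact key α β p hpq hp
    by_cases hpi : p = i
    · subst hpi
      exact (key β α q hqi hq).symm
    -- The directions `p`, `q`, `i` are now distinct, which forces `k ≥ 1`; the faces of `T' α p`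
    -- can then be computed by `fc_cp`.
    match k, T, hT, h₁, h₂, hi, B, B', D, D', T', hp, hq, hT', hBT, hTD, hBTD with
    | 0, _, _, _, _, _, _, _, _, _, _, _, _, _, _, _, _ => omega
    | k + 1, T, hT, h₁, h₂, hi, B, B', D, D', T', hp, hq, hT', hBT, hTD, hBTD =>
      have bound : ∀ {a b : ℕ}, a ≠ b → a ≤ k + 2 → b ≤ k + 2 → drop a b ≤ k + 1 := by
        intro a b h₁ h₂ h₃
        unfold drop
        split_ifs <;> omega
      have ne : ∀ {a b c : ℕ}, a ≠ b → a ≠ c → b ≠ c → drop a b ≠ drop a c := by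
        intro a b c h₁ h₂ h₃
        unfold drop
        split_ifs <;> omega
      -- The position of `i` does not depend on the order in which `p` and `q` are removed, so both
      -- sides are composites in one direction, compared factor by factor.
      have e : drop (drop p q) (drop p i) = drop (drop q p) (drop q i) := by
        unfold drop
        split_ifs <;> omega
      rw [hT' α p hpi, hT' β q hqi,
        C.fc_cp (ne hpq hpi hqi) (bound hpi hp hi) (bound hpq hp hq) β (hBTD α p hpi hp),
        C.fc_cp (ne hpq hpi hqi) (bound hpi hp hi) (bound hpq hp hq) β (hTD α p hpi hp),
        C.fc_cp (ne hpq.symm hqi hpi) (bound hqi hq hi) (bound hpq.symm hq hp) α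
          (hBTD β q hqi hq),
        C.fc_cp (ne hpq.symm hqi hpi) (bound hqi hq hi) (bound hpq.symm hq hp) α
          (hTD β q hqi hq),
        e, C.fc_fc hpq hq hp, C.fc_fc hpq hq hp, hT α β q p hpq hq hp]
  · intro A' hA'
    have hA'D : C.fc true i A' = C.fc false i D' := by rw [hA' _ _ hi, hT'true, hD']
    have hB'A' : C.fc true i B' = C.fc false i A' := by rw [hA' _ _ hi, hT'false, hB']
    have hB'A'D : C.fc true i B' = C.fc false i (C.cp i A' D') := by
      rw [C.fc_false_cp hA'D, hB'A']
    refine ⟨C.cp i B' (C.cp i A' D'), fun α p hp => ?_⟩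
    by_cases hpi : p = i
    · subst hpi
      cases α
      · rw [C.fc_false_cp hB'A'D, hB'T]
      · rw [C.fc_true_cp hB'A'D, C.fc_true_cp hA'D, hD'T]
    · rw [C.fc_cp hpi hi hp α hB'A'D, C.fc_cp hpi hi hp α hA'D, hA' α p hp, hT' α p hpi]
      -- The face is `B' ∘ ((B ∘ (T ∘ D)) ∘ D')`, up to taking faces of the collars; after
      -- reassociation `D ∘ D'` and `B' ∘ B` cancel as identities.
      have cB := C.composable_fc hpi hi hp α hB'
      have cD := C.composable_fc hpi hi hp α hD'
      have eB : C.cp (drop p i) (C.fc α p B') (C.fc α p B) =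
          C.dg h₁ (drop p i) (C.fc α (drop i p) (T false i)) := by
        rw [← C.fc_cp hpi hi hp α hB', hBB, C.fc_dg hpi hi hp h₁]
      have eD : C.cp (drop p i) (C.fc α p D) (C.fc α p D') =
          C.dg h₁ (drop p i) (C.fc α (drop i p) (T true i)) := by
        rw [← C.fc_cp hpi hi hp α hD', hDD, C.fc_dg hpi hi hp h₁]
      have cTD : C.fc true (drop p i) (C.cp (drop p i) (T α p) (C.fc α p D)) =
          C.fc false (drop p i) (C.fc α p D') := by
        rw [C.fc_true_cp (hTD α p hpi hp), cD]
      rw [← C.cp_assoc (hBTD α p hpi hp) cTD, ← C.cp_assoc (hTD α p hpi hp) cD, eD,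
        C.cp_dg h₁ (hT α true i p hpi hi hp), C.cp_assoc cB (hBT α p hpi hp), eB,
        C.dg_cp h₁ (hT α false i p hpi hi hp)]

/-! ### Totally degenerate cells -/

section Star

variable (x : C.Cell 0)

theorem face_iterDeg : ∀ {k : ℕ} (h₁ : ((k + 1 : ℕ) : ℕ∞) ≤ N) (h₀ : (k : ℕ∞) ≤ N) (α : Bool)
    (i : Fin (k + 1)), C.face α i (C.iterDeg (k + 1) h₁ x) = C.iterDeg k h₀ x
  | 0, h₁, h₀, α, i => by
    obtain rfl : i = Fin.last 0 := Subsingleton.elim (α := Fin 1) _ _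
    exact C.face_deg_self _ _ _ _
  | k + 1, h₁, h₀, α, i => by
    rw [iterDeg]
    induction i using Fin.lastCases with
    | last => exact C.face_deg_self _ _ _ _
    | cast i =>
      rw [← Fin.succ_last, C.face_deg_lt h₀ _ _ _ _ _ (Fin.le_last i),
        face_iterDeg h₀ ((Nat.cast_le.mpr k.le_succ).trans h₀)]
      rfl

/-- Degeneracies commute up to a shift, so any of them can be moved inwards past the last one; the
direction chosen does not matter. -/
theorem deg_iterDeg : ∀ {k : ℕ} (h₁ : ((k + 1 : ℕ) : ℕ∞) ≤ N) (h₀ : (k : ℕ∞) ≤ N)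
    (i : Fin (k + 1)), C.deg h₁ i (C.iterDeg k h₀ x) = C.iterDeg (k + 1) h₁ x
  | 0, h₁, h₀, i => by
    obtain rfl : i = Fin.last 0 := Subsingleton.elim (α := Fin 1) _ _
    rfl
  | k + 1, h₁, h₀, i => by
    induction i using Fin.lastCases with
    | last => rfl
    | cast i =>
      rw [iterDeg, C.deg_deg h₀ h₁ _ _ _ (Fin.le_last i), deg_iterDeg h₀, Fin.succ_last]
      rfl

/-- The cell can be written as a degeneracy in the direction `i` itself, where a connection reduces
to a second degeneracy. -/
theorem conn_iterDeg {k : ℕ} (h₂ : ((k + 2 : ℕ) : ℕ∞) ≤ N) (h₁ : ((k + 1 : ℕ) : ℕ∞) ≤ N)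
    (α : Bool) (i : Fin (k + 1)) :
    C.conn h₂ α i (C.iterDeg (k + 1) h₁ x) = C.iterDeg (k + 2) h₂ x := by
  have h₀ : (k : ℕ∞) ≤ N := (Nat.cast_le.mpr k.le_succ).trans h₁
  rw [← C.deg_iterDeg x h₁ h₀ i, C.conn_deg_self, deg_iterDeg, deg_iterDeg]

theorem fc_iterDeg {k : ℕ} (h₁ : ((k + 1 : ℕ) : ℕ∞) ≤ N) (h₀ : (k : ℕ∞) ≤ N) (α : Bool)
    (i : ℕ) : C.fc α i (C.iterDeg (k + 1) h₁ x) = C.iterDeg k h₀ x := face_iterDeg x h₁ h₀ α _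

theorem dg_iterDeg {k : ℕ} (h₁ : ((k + 1 : ℕ) : ℕ∞) ≤ N) (h₀ : (k : ℕ∞) ≤ N) (i : ℕ) :
    C.dg h₁ i (C.iterDeg k h₀ x) = C.iterDeg (k + 1) h₁ x := deg_iterDeg x h₁ h₀ _

theorem cn_iterDeg {k : ℕ} (h₂ : ((k + 2 : ℕ) : ℕ∞) ≤ N) (h₁ : ((k + 1 : ℕ) : ℕ∞) ≤ N)
    (i : ℕ) : C.cn h₂ i (C.iterDeg (k + 1) h₁ x) = C.iterDeg (k + 2) h₂ x :=
  conn_iterDeg x h₂ h₁ _ _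

theorem iterDeg_cp {k i : ℕ} (h₁ : ((k + 1 : ℕ) : ℕ∞) ≤ N) (h₀ : (k : ℕ∞) ≤ N)
    {a : C.Cell (k + 1)} (ha : C.fc false i a = C.iterDeg k h₀ x) :
    C.cp i (C.iterDeg (k + 1) h₁ x) a = a := by
  rw [← dg_iterDeg x h₁ h₀ i, C.dg_cp h₁ ha]

/-- The faces of an inverse that correspond to totally degenerate faces are totally degenerate. -/
theorem fc_inverse_eq_iterDeg {k i p : ℕ} (hip : p ≠ i) (hi : i ≤ k + 1) (hp : p ≤ k + 1)
    (h₁ : ((k + 1 : ℕ) : ℕ∞) ≤ N) (h₂ : ((k + 2 : ℕ) : ℕ∞) ≤ N) (α : Bool)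
    {A B : C.Cell (k + 2)} (hAB : C.fc true i A = C.fc false i B)
    (h : C.cp i A B = C.dg h₂ i (C.fc false i A)) (hA : C.fc α p A = C.iterDeg (k + 1) h₁ x) :
    C.fc α p B = C.iterDeg (k + 1) h₁ x := by
  have h₀ : (k : ℕ∞) ≤ N := (Nat.cast_le.mpr k.le_succ).trans h₁
  -- In the face of `A ∘ B` the first factor is an identity, so what remains is the face of `B`.
  have e := congrArg (C.fc α p) h
  have c := C.composable_fc hip hi hp α hAB
  rw [hA, fc_iterDeg x h₁ h₀] at c
  rwa [C.fc_cp hip hi hp α hAB, hA, iterDeg_cp x h₁ h₀ c.symm, C.fc_dg hip hi hp h₁,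
    ← C.fc_fc hip hi hp, hA, fc_iterDeg x h₁ h₀, dg_iterDeg] at e

end Star

/-! ### Turning the contraction into any direction -/

theorem Contraction.σ_iterDeg {ι : C.ProjSection} (c : C.Contraction ι) (u : C.Quotient₀) :
    ∀ {k : ℕ} (h₁ : ((k + 1 : ℕ) : ℕ∞) ≤ N) (h₀ : (k : ℕ∞) ≤ N),
      c.σ h₁ (C.iterDeg k h₀ (ι.rep u)) = C.iterDeg (k + 1) h₁ (ι.rep u)
  | 0, h₁, _ => c.σ_rep h₁ u
  | k + 1, h₁, h₀ => by
    rw [iterDeg, c.σ_deg h₀ h₁, c.σ_iterDeg u h₀, deg_iterDeg]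

/-- A cell `g` whose faces in the directions below `m` are totally degenerate is the lower face, in
any direction `j ≤ m`, of a cell whose other faces in the directions up to `m` are totally
degenerate. -/
theorem Contraction.exists_extension (hG : C.IsGroupoid) {ι : C.ProjSection}
    (c : C.Contraction ι) (u : C.Quotient₀) {k : ℕ} (h₀ : (k : ℕ∞) ≤ N)
    (h₁ : ((k + 1 : ℕ) : ℕ∞) ≤ N) (h₂ : ((k + 2 : ℕ) : ℕ∞) ≤ N) {g : C.Cell (k + 1)}
    (hg : C.proj g = u) {m : ℕ} (hm : m ≤ k + 1)
    (hgm : ∀ α p, p < m → C.fc α p g = C.iterDeg k h₀ (ι.rep u)) :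
    ∀ j ≤ m, ∃ X : C.Cell (k + 2), C.fc false j X = g ∧
      C.fc true j X = C.iterDeg (k + 1) h₁ (ι.rep u) ∧
      ∀ α p, p ≤ m → p ≠ j → C.fc α p X = C.iterDeg (k + 1) h₁ (ι.rep u) := by
  intro j
  induction j with
  | zero =>
    intro _
    -- A face of `σ g` in direction `p ≥ 1` is `σ` of the face of `g` in direction `p - 1 < m`,
    -- hence totally degenerate.
    refine ⟨c.σ h₂ g, c.face_zero_neg _ _, ?_, fun α p hp hp0 => ?_⟩
    · rw [← hg]
      exact c.face_zero_pos _ _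
    · obtain ⟨p, rfl⟩ := Nat.exists_eq_succ_of_ne_zero hp0
      rw [Nat.succ_eq_add_one, fc, ofNat_succ (by omega), c.face_succ h₁, ← fc,
        hgm α p (by omega), c.σ_iterDeg]
  | succ j ih =>
    intro hj
    obtain ⟨X, hXg, hXs, hX⟩ := ih (by omega)
    obtain ⟨B, hXB, hBX, hXBdg, -⟩ := hG.exists_inverse h₂ j X
    have hB : ∀ α p, p ≤ m → p ≠ j → C.fc α p B = C.iterDeg (k + 1) h₁ (ι.rep u) :=
      fun α p hp hpj => fc_inverse_eq_iterDeg _ hpj (by omega) (by omega) h₁ h₂ α hXB hXBdg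
        (hX α p hp hpj)
    have hjk : j ≤ k := by omega
    have hc : C.fc true j B = C.fc false j (C.cn h₂ j g) := by
      rw [hBX, hXg, C.fc_false_cn h₂ hjk]
    have ed : drop (j + 1) j = j := by rw [drop, if_neg (by omega)]
    -- The negative connection has `g` as lower face in both directions `j` and `j + 1`. Gluing the
    -- inverse of `X` replaces the copy in direction `j` by a degenerate face and keeps the other.
    refine ⟨C.cp j B (C.cn h₂ j g), ?_, ?_, fun α p hp hpj => ?_⟩
    · rw [C.fc_cp (by omega) (by omega) (by omega) _ hc, hB _ _ hj (by omega), ed,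
        C.fc_false_succ_cn h₂ hjk, iterDeg_cp _ h₁ h₀ (hgm _ _ (by omega))]
    · rw [C.fc_cp (by omega) (by omega) (by omega) _ hc, hB _ _ hj (by omega), ed,
        C.fc_true_succ_cn h₁ h₂ hjk, hgm _ _ (by omega), dg_iterDeg,
        iterDeg_cp _ h₁ h₀ (fc_iterDeg _ _ _ _ _)]
    · by_cases hpj' : p = j
      · subst hpj'
        cases α
        · rw [C.fc_false_cp hc, ← hXB, hXs]
        · rw [C.fc_true_cp hc, C.fc_true_cn h₁ h₂ hjk, hgm _ _ (by omega), dg_iterDeg]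
      -- For `p < j` or `p > j + 1` this face is a connection on the face of `g` in direction `p` or
      -- `p - 1`, which is below `m` in both cases.
      · have e : C.fc α p (C.cn h₂ j g) = C.iterDeg (k + 1) h₁ (ι.rep u) := by
          obtain ⟨k, rfl⟩ : ∃ l, k = l + 1 := ⟨k - 1, by omega⟩
          rcases Nat.lt_or_gt_of_ne hpj' with hlt | hlt
          · obtain ⟨j, rfl⟩ : ∃ l, j = l + 1 := ⟨j - 1, by omega⟩
            rw [C.fc_cn_of_lt h₁ h₂ (by omega) (by omega), hgm _ _ (by omega), cn_iterDeg]
          · obtain ⟨p, rfl⟩ : ∃ l, p = l + 2 := ⟨p - 2, by omega⟩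
            rw [C.fc_cn_of_gt h₁ h₂ (by omega) (by omega), hgm _ _ (by omega), cn_iterDeg]
        rw [C.fc_cp hpj' (by omega) (by omega) _ hc, hB _ _ hp hpj', e,
          iterDeg_cp _ h₁ h₀ (fc_iterDeg _ _ _ _ _)]

/-! ### Filling squares over one class -/

/-- The class is read off by lower faces in the last direction. Other faces commute with these, and
the last direction reduces to the others after one more face in direction `0`. In dimension `1` the
two ends are identified by the quotient. -/
theorem proj_face : ∀ {k : ℕ} (α : Bool) (i : Fin (k + 1)) (f : C.Cell (k + 1)),
    C.proj (C.face α i f) = C.proj f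
  | 0, α, i, f => by
    obtain rfl : i = Fin.last 0 := Subsingleton.elim (α := Fin 1) _ _
    cases α
    · rfl
    · exact (Quot.sound ⟨f, rfl, rfl⟩).symm
  | k + 1, α, i, f => by
    have key : ∀ (α : Bool) (i : Fin (k + 1)), C.proj (C.face α i.castSucc f) = C.proj f := by
      intro α i
      have e := C.face_face α false i (Fin.last k) f (Fin.le_last i)
      rw [Fin.succ_last] at e
      calc C.proj (C.face α i.castSucc f)
          = C.proj (C.face false (Fin.last k) (C.face α i.castSucc f)) := rfl
        _ = C.proj (C.face false (Fin.last (k + 1)) f) := by rw [← e, proj_face]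
        _ = C.proj f := rfl
    induction i using Fin.lastCases with
    | cast i => exact key α i
    | last =>
      rw [← proj_face false 0, ← Fin.succ_last, C.face_face _ _ _ _ _ (Fin.zero_le _), proj_face,
        key]

/-- A square of cells over `u` whose faces in the directions below `m` are totally degenerate has a
filler. -/
theorem Contraction.exists_filler (hG : C.IsGroupoid) {ι : C.ProjSection}
    (c : C.Contraction ι) (u : C.Quotient₀) {k : ℕ} (h₁ : ((k + 1 : ℕ) : ℕ∞) ≤ N)
    (h₂ : ((k + 2 : ℕ) : ℕ∞) ≤ N) {m : ℕ} (hm : m ≤ k + 2) :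
    ∀ T : Bool → ℕ → C.Cell (k + 1), C.IsNatSquare T →
      (∀ α p, p ≤ k + 1 → C.proj (T α p) = u) →
      (∀ α p, p < m → T α p = C.iterDeg (k + 1) h₁ (ι.rep u)) →
      ∃ A : C.Cell (k + 2), ∀ α p, p ≤ k + 1 → C.fc α p A = T α p := by
  have h₀ : (k : ℕ∞) ≤ N := (Nat.cast_le.mpr k.le_succ).trans h₁
  induction hm using Nat.decreasingInduction with
  | self =>
    intro T _ _ hTs
    exact ⟨C.iterDeg (k + 2) h₂ (ι.rep u), fun α p hp => by
      rw [fc_iterDeg _ _ h₁, hTs α p (by omega)]⟩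
  | of_succ m hm ih =>
    intro T hT hTu hTs
    -- These faces of `T α m` are also faces of the degenerate cells `T β p`, by the square
    -- relations.
    have hface : ∀ α β p, p < m → C.fc β p (T α m) = C.iterDeg k h₀ (ι.rep u) := by
      intro α β p hp
      have e := hT β α m p (by omega) (by omega) (by omega)
      rw [hTs β p hp, fc_iterDeg _ _ h₀, drop, if_neg (by omega)] at e
      exact e.symm
    obtain ⟨B', hB'T, hB's, hB'⟩ := c.exists_extension hG u h₀ h₁ h₂ (hTu false m (by omega))
      (show m ≤ k + 1 by omega) (hface false) m le_rfl
    obtain ⟨D, hDT, hDs, hD⟩ := c.exists_extension hG u h₀ h₁ h₂ (hTu true m (by omega))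
      (show m ≤ k + 1 by omega) (hface true) m le_rfl
    obtain ⟨B, hB'B, hBB', hB'Bdg, -⟩ := hG.exists_inverse h₂ m B'
    obtain ⟨D', hDD', hD'D, hDD'dg, -⟩ := hG.exists_inverse h₂ m D
    have hB : ∀ α p, p < m → C.fc α p B = C.iterDeg (k + 1) h₁ (ι.rep u) :=
      fun α p hp => fc_inverse_eq_iterDeg _ hp.ne (by omega) (by omega) h₁ h₂ α hB'B hB'Bdg
        (hB' α p hp.le hp.ne)
    let T' : Bool → ℕ → C.Cell (k + 1) := fun α p =>
      if p = m then C.iterDeg (k + 1) h₁ (ι.rep u) else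
        C.cp (drop p m) (C.fc α p B) (C.cp (drop p m) (T α p) (C.fc α p D))
    have hT'm : ∀ α, T' α m = C.iterDeg (k + 1) h₁ (ι.rep u) := fun α => if_pos rfl
    have hT'ne : ∀ α p, p ≠ m → T' α p =
        C.cp (drop p m) (C.fc α p B) (C.cp (drop p m) (T α p) (C.fc α p D)) :=
      fun α p hp => if_neg hp
    obtain ⟨hT', hfill⟩ := hT.exists_filler_of_comp h₁ h₂ (show m ≤ k + 1 by omega)
      (hBB'.trans hB'T) hB'B (by rw [hB'Bdg, hB'T]) hB'T hDT hDD' (by rw [hDD'dg, hDT])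
      (hD'D.trans hDT) (by rw [hT'm, ← hB'B, hB's]) (by rw [hT'm, hDs]) hT'ne
    have hT's : ∀ α p, p < m + 1 → T' α p = C.iterDeg (k + 1) h₁ (ι.rep u) := by
      intro α p hp
      by_cases hpm : p = m
      · rw [hpm, hT'm]
      · have hlt : p < m := by omega
        rw [hT'ne α p hpm, hB α p hlt, hTs α p hlt, hD α p hlt.le hpm,
          iterDeg_cp _ h₁ h₀ (fc_iterDeg _ _ _ _ _), iterDeg_cp _ h₁ h₀ (fc_iterDeg _ _ _ _ _)]
    have hproj : ∀ α p, p ≤ k + 1 → C.proj (T' α p) = u := by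
      -- The degenerate cell and `T false m` are opposite faces of `B'`, so they have the same
      -- class. Every other `T' α p` shares a face with `T' false m`.
      have hm : C.proj (T' false m) = u := by
        rw [hT'm, ← hB's, fc, proj_face, ← proj_face false (Fin.ofNat _ m), ← fc, hB'T]
        exact hTu _ _ (by omega)
      intro α p hp
      by_cases hpm : p = m
      · rw [hpm, hT'm, ← hT'm false, hm]
      · rw [← hm, ← proj_face false (Fin.ofNat _ (drop p m)), ← fc,
          hT' α false m p hpm (by omega) hp, fc, proj_face]
    obtain ⟨A', hA'⟩ := ih T' hT' hproj hT's
    exact hfill A' hA'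

/-! ### Acyclicity -/

theorem IsSquare.isNatSquare {k : ℕ} {S : Bool → Fin (k + 2) → C.Cell (k + 1)}
    (hS : C.IsSquare S) : C.IsNatSquare fun α p => S α (Fin.ofNat _ p) := by
  have key : ∀ (α β : Bool) (i p : ℕ), p < i → i ≤ k + 1 →
      C.fc β (drop p i) (S α (Fin.ofNat _ p)) = C.fc α (drop i p) (S β (Fin.ofNat _ i)) := by
    intro α β i p hpi hi
    obtain ⟨i, rfl⟩ : ∃ j, i = j + 1 := ⟨i - 1, by omega⟩
    rw [drop, drop, if_pos hpi, if_neg (by omega), Nat.add_sub_cancel,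
      ofNat_castSucc (i := p) (by omega), ofNat_succ (by omega)]
    exact (hS α β _ _ (ofNat_le_ofNat (by omega) (by omega))).symm
  intro α β i p hpi hi hp
  rcases Nat.lt_or_gt_of_ne hpi with h | h
  · exact key α β i p h hi
  · exact (key β α p i h hp).symm

/-- Each face in a direction `j + 1` shares a face with both faces in direction `0`. This takes a
second direction, which a `0`-square lacks. -/
theorem IsSquare.proj_eq {k : ℕ} {S : Bool → Fin (k + 2) → C.Cell (k + 1)}
    (hS : C.IsSquare S) (α : Bool) (i : Fin (k + 2)) : C.proj (S α i) = C.proj (S false 0) := by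
  have key : ∀ (α β : Bool) (j : Fin (k + 1)), C.proj (S β j.succ) = C.proj (S α 0) := by
    intro α β j
    rw [← proj_face α 0, hS α β 0 j (Fin.zero_le _), proj_face, Fin.castSucc_zero]
  induction i using Fin.cases with
  | zero => rw [← key α false 0, key false]
  | succ j => exact key false α j

theorem IsGroupoid.isAcyclic (hG : C.IsGroupoid) (hC : C.IsContracting) : C.IsAcyclic := by
  obtain ⟨ι, ⟨c⟩⟩ := hC
  constructor
  · intro k hk hN S hS
    obtain ⟨k, rfl⟩ : ∃ l, k = l + 1 := ⟨k - 1, by omega⟩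
    -- With `m = 0` nothing is required to be degenerate.
    obtain ⟨A, hA⟩ := c.exists_filler hG (C.proj (S false 0))
      ((Nat.cast_le.mpr (k + 1).le_succ).trans hN) hN (Nat.zero_le _) _ hS.isNatSquare
      (fun α p _ => hS.proj_eq α _) (fun _ _ h => absurd h (Nat.not_lt_zero _))
    refine ⟨A, funext fun α => funext fun i => ?_⟩
    have e := hA α i.val (by omega)
    rwa [fc_val, ofNat_val] at e
  · intro hN S hS
    have h₁ : ((0 + 1 : ℕ) : ℕ∞) ≤ N := by simpa using hN
    obtain ⟨B, hDB, hBD, -⟩ := hG.exists_inverse h₁ 0 (c.σ h₁ (S true 0))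
    have hc : C.fc true 0 (c.σ h₁ (S false 0)) = C.fc false 0 B := by
      rw [← hDB]
      -- Both contraction cells end at the representative of the common class.
      refine (c.face_zero_pos h₁ _).trans (Eq.trans ?_ (c.face_zero_pos h₁ _).symm)
      exact congrArg (fun u => C.iterDeg 0 _ (ι.rep u)) hS
    refine ⟨C.cp 0 (c.σ h₁ (S false 0)) B, funext fun α => funext fun i => ?_⟩
    obtain rfl : i = 0 := Subsingleton.elim (α := Fin 1) _ _
    cases α
    · exact (C.fc_false_cp hc).trans (c.face_zero_neg h₁ _)
    · exact (C.fc_true_cp hc).trans (hBD.trans (c.face_zero_neg h₁ _))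

end CubicalCategory

/-- Every contracting cubical `N`-groupoid, where `N = ⊤` (the case of `ω`-groupoids) or `N = n` is a
natural number, is acyclic. -/
theorem theoremT (N : ℕ∞) (C : CubicalCategory N) (hG : C.IsGroupoid) (hC : C.IsContracting) :
    C.IsAcyclic :=
  hG.isAcyclic hC
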